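/- Consider the two-stage adaptive robust linear optimization problem with fixed recourse $$(P)\qquad \min_{x,\,y(\cdot)}\ \sup_{z\in U}\ c(z)^\top x+d^\top y(z)\quad\text{s.t.}\quad A(z)x+By(z)\le r(z)\quad\forall z\in U,$$ where $x\in\mathbb{R}^{n_x}$, $y(\cdot)$ ranges over all functions $\mathbb{R}^L\to\mathbb{R}^{n_y}$, the data $c(z)\in\mathbb{R}^{n_x}$, $A(z)\in\mathbb{R}^{m\times n_x}$ and $r(z)\in\mathbb{R}^m$ are affine functions of $z$, $d\in\mathbb{R}^{n_y}$ and $B\in\mathbb{R}^{m\times n_y}$ do not depend on $z$, and $U\subseteq\mathbb{R}^L$ is convex and compact with nonempty relative interior. A pair $(x,y(\cdot))$ is *adaptive robustly feasible* (ARF) if it satisfies the constraints of $(P)$ for all $z\in U$. It is *adaptive robustly optimal* (ARO) if it is ARF and its worst-case value $\sup_{z\in U}\{c(z)^\top x+d^\top y(z)\}\in(-\infty,+\infty]$ is minimal among all ARF pairs. A vector $x^*$ is *Pareto adaptive robustly optimal* (PARO) if there is a $y^*(\cdot)$ such that $(x^*,y^*(\cdot))$ is ARO and there is no ARO pair $(\bar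 x,\bar y(\cdot))$ with $$c(z)^\top\bar x+d^\top\bar y(z)\le c(z)^\top x^*+d^\top y^*(z)\quad\text{for all } z\in U,$$ with strict inequality for some $z\in U$. **Theorem.** Suppose that the feasible region $$\mathcal{X}=\{x\in\mathbb{R}^{n_x} : \text{there is a } y(\cdot) \text{ with } A(z)x+By(z)\le r(z)\ \ \forall z\in U\}$$ is compact and nonempty, and that the optimal value of $(P)$ (the infimum of the worst-case value over all ARF pairs) is not $-\infty$. Then there exists a PARO solution $x^*$ to $(P)$. -/

import Mathlib

open scoped Matrix

/-- The data of a two-stage adaptive robust linear optimization problem with fixed recourse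
`min_{x, y(·)} max_{z ∈ U} c(z)ᵀ x + dᵀ y(z)` subject to `A(z) x + B y(z) ≤ r(z)` for all `z ∈ U`.
Here `x ∈ ℝ^nx` is the here-and-now decision, `y : ℝ^L → ℝ^ny` is the wait-and-see decision rule,
`c`, `A`, `r` depend affinely on the uncertain parameter `z ∈ ℝ^L`, and (fixed recourse) `d` and `B`
do not depend on `z`. -/
structure AdaptiveRobustProblem (L nx ny m : ℕ) where
  /-- the uncertainty set -/
  U : Set (Fin L → ℝ)
  /-- first-stage cost -/
  c : (Fin L → ℝ) →ᵃ[ℝ] (Fin nx → ℝ)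
  /-- second-stage cost -/
  d : Fin ny → ℝ
  /-- first-stage constraint matrix -/
  A : (Fin L → ℝ) →ᵃ[ℝ] Matrix (Fin m) (Fin nx) ℝ
  /-- recourse matrix -/
  B : Matrix (Fin m) (Fin ny) ℝ
  /-- right-hand side -/
  r : (Fin L → ℝ) →ᵃ[ℝ] (Fin m → ℝ)

namespace AdaptiveRobustProblem

variable {L nx ny m : ℕ}

/-- The objective value `c(z)ᵀ x + dᵀ y(z)` of the pair `(x, y(·))` in scenario `z`. -/
def objective (P : AdaptiveRobustProblem L nx ny m)
    (x : Fin nx → ℝ) (y : (Fin L → ℝ) → (Fin ny → ℝ)) (z : Fin L → ℝ) : ℝ :=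
  P.c z ⬝ᵥ x + P.d ⬝ᵥ y z

/-- The pair `(x, y(·))` is adaptive robustly feasible (ARF). The decision rule is an arbitrary
function, and `≤` is componentwise. -/
def IsARF (P : AdaptiveRobustProblem L nx ny m)
    (x : Fin nx → ℝ) (y : (Fin L → ℝ) → (Fin ny → ℝ)) : Prop :=
  ∀ z ∈ P.U, P.A z *ᵥ x + P.B *ᵥ y z ≤ P.r z

/-- The feasible region of the here-and-now decisions: all `x` that are part of an ARF pair. -/
def feasibleRegion (P : AdaptiveRobustProblem L nx ny m) : Set (Fin nx → ℝ) :=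
  {x | ∃ y : (Fin L → ℝ) → (Fin ny → ℝ), P.IsARF x y}

/-- The worst-case objective value of a pair over the uncertainty set; it is `⊤` if the objective is
unbounded above on `U`. -/
noncomputable def worstCase (P : AdaptiveRobustProblem L nx ny m)
    (x : Fin nx → ℝ) (y : (Fin L → ℝ) → (Fin ny → ℝ)) : EReal :=
  ⨆ z ∈ P.U, (P.objective x y z : EReal)

/-- The optimal (worst-case) objective value: the infimum of the worst-case value over ARF pairs. -/
noncomputable def optimalValue (P : AdaptiveRobustProblem L nx ny m) : EReal :=
  ⨅ (x : Fin nx → ℝ) (y : (Fin L → ℝ) → (Fin ny → ℝ)) (_ : P.IsARF x y), P.worstCase x y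

/-- The pair `(x, y(·))` is adaptive robustly optimal (ARO): it is ARF and its worst-case objective
value is minimal among all ARF pairs. -/
def IsARO (P : AdaptiveRobustProblem L nx ny m)
    (x : Fin nx → ℝ) (y : (Fin L → ℝ) → (Fin ny → ℝ)) : Prop :=
  P.IsARF x y ∧ ∀ (x' : Fin nx → ℝ) (y' : (Fin L → ℝ) → (Fin ny → ℝ)),
    P.IsARF x' y' → P.worstCase x y ≤ P.worstCase x' y'

/-- `(x', y'(·))` is at least as good as `(x, y(·))` in every scenario of `U` and strictly better in
some scenario of `U`. -/
def Dominates (P : AdaptiveRobustProblem L nx ny m)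
    (x' : Fin nx → ℝ) (y' : (Fin L → ℝ) → (Fin ny → ℝ))
    (x : Fin nx → ℝ) (y : (Fin L → ℝ) → (Fin ny → ℝ)) : Prop :=
  (∀ z ∈ P.U, P.objective x' y' z ≤ P.objective x y z) ∧
    ∃ z ∈ P.U, P.objective x' y' z < P.objective x y z

/-- The here-and-now decision `x` is Pareto adaptive robustly optimal (PARO): for some decision rule
`y(·)` the pair `(x, y(·))` is ARO and is not dominated by any ARO pair. -/
def IsPARO (P : AdaptiveRobustProblem L nx ny m) (x : Fin nx → ℝ) : Prop :=
  ∃ y : (Fin L → ℝ) → (Fin ny → ℝ), P.IsARO x y ∧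
    ¬ ∃ (x' : Fin nx → ℝ) (y' : (Fin L → ℝ) → (Fin ny → ℝ)),
      P.IsARO x' y' ∧ P.Dominates x' y' x y

end AdaptiveRobustProblem

/-!
Write `q(x, z)` for the best objective value attainable in scenario `z` after the decision `x`. The
proof rests on a single fact about linear programs: the set of pairs `(b, t)` for which
`B y ≤ b`, `dᵀ y ≤ t` has a solution `y` is an intersection of finitely many closed halfspaces
(`HalfspaceCone.project_sum`, by Fourier–Motzkin elimination), hence closed
(`isClosed_recourseCone`). It has two consequences.

* If the optimal value of the problem is not `⊥`, then the infimum defining `q(x, z)` is attained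
  (`exists_minimal_recourse`): were `dᵀ y` unbounded below on some `{y | B y ≤ b}`, rescaling and
  closedness would give a direction `v` with `B v ≤ 0` and `dᵀ v < 0`, and moving any decision rule
  along `v` would push the worst-case value to `⊥`. So every feasible `x` has a decision rule that
  is optimal in all scenarios at once.
* Every condition of the form `q(x, z) ≤ t` is closed in `x`, and so are conditions that require
  it for a whole family of pairs `(z, t)` (`isClosed_setOf_recourse_le`).

A preorder with closed lower sets on a nonempty compact set has a minimal element, by Zorn's lemma
and Cantor's intersection theorem (`IsCompact.exists_minimal_of_isClosed_lower`). Applied to the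
worst-case value on the feasible region this yields an adaptive robustly optimal decision; applied
to the scenario-wise comparison of `q(x, ·)` on the compact set of all such decisions it yields one
that no other dominates. No continuity in `z` is involved.
-/

/-! ### Fourier–Motzkin elimination -/

section HalfspaceCone

variable {E : Type*} [AddCommGroup E] [Module ℝ E] [TopologicalSpace E]

/-- The set `S` is the intersection of finitely many closed halfspaces through the origin. -/
def HalfspaceCone (S : Set E) : Prop :=
  ∃ F : Finset (E →L[ℝ] ℝ), S = {x | ∀ f ∈ F, 0 ≤ f x}

theorem HalfspaceCone.isClosed {S : Set E} (hS : HalfspaceCone S) : IsClosed S := by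
  obtain ⟨F, rfl⟩ := hS
  simp only [Set.ofPred_forall]
  exact isClosed_biInter fun f _ => isClosed_le continuous_const f.continuous

theorem exists_between_finset {s t : Finset ℝ} (h : ∀ a ∈ s, ∀ b ∈ t, a ≤ b) :
    ∃ c, (∀ a ∈ s, a ≤ c) ∧ ∀ b ∈ t, c ≤ b := by
  rcases s.eq_empty_or_nonempty with rfl | hs
  · obtain ⟨c, hc⟩ := t.bddBelow
    exact ⟨c, by simp, fun b hb => hc hb⟩
  · exact ⟨s.max' hs, fun a ha => s.le_max' a ha, fun b hb => s.max'_le hs _ fun a ha => h a ha b hb⟩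

/-- One step of Fourier–Motzkin elimination. -/
theorem HalfspaceCone.project {S : Set E} (hS : HalfspaceCone S) (v : E) :
    HalfspaceCone {x | ∃ t : ℝ, x - t • v ∈ S} := by
  classical
  obtain ⟨F, rfl⟩ := hS
  -- A functional with `f v < 0` bounds `t` from below by `f x / f v`, one with `g v > 0` bounds it
  -- from above by `g x / g v`; each such pair contributes one inequality on `x`.
  refine ⟨F.filter (fun f => f v = 0) ∪
    ((F.filter fun f => f v < 0) ×ˢ (F.filter fun g => 0 < g v)).image
      fun p => p.2 v • p.1 - p.1 v • p.2, ?_⟩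
  ext x
  simp only [Set.mem_ofPred_eq, map_sub, map_smul, smul_eq_mul]
  constructor
  · rintro ⟨t, ht⟩ f hf
    simp only [Finset.mem_union, Finset.mem_filter, Finset.mem_image, Finset.mem_product,
      Prod.exists] at hf
    rcases hf with ⟨hf, hv⟩ | ⟨f, g, ⟨⟨hf, hfv⟩, hg, hgv⟩, rfl⟩
    · simpa [hv] using ht f hf
    · simp only [sub_apply, smul_apply, smul_eq_mul]
      nlinarith [mul_nonneg hgv.le (ht f hf), mul_nonneg (neg_pos.2 hfv).le (ht g hg)]
  · intro h
    obtain ⟨t, hlow, hup⟩ := exists_between_finset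
      (s := (F.filter fun f => f v < 0).image fun f => f x / f v)
      (t := (F.filter fun g => 0 < g v).image fun g => g x / g v) (by
        simp only [Finset.mem_image, Finset.mem_filter]
        rintro _ ⟨f, ⟨hf, hfv⟩, rfl⟩ _ ⟨g, ⟨hg, hgv⟩, rfl⟩
        have := h (g v • f - f v • g) (Finset.mem_union_right _ (Finset.mem_image.2
          ⟨(f, g), by simp [hf, hfv, hg, hgv], rfl⟩))
        simp only [sub_apply, smul_apply,
          smul_eq_mul] at this
        rw [div_le_iff_of_neg hfv, div_mul_eq_mul_div, div_le_iff₀ hgv]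
        linarith)
    refine ⟨t, fun f hf => ?_⟩
    rcases lt_trichotomy (f v) 0 with hv | hv | hv
    · have := hlow _ (Finset.mem_image_of_mem _ (Finset.mem_filter.2 ⟨hf, hv⟩))
      rw [div_le_iff_of_neg hv] at this
      linarith
    · have := h f (Finset.mem_union_left _ (Finset.mem_filter.2 ⟨hf, hv⟩))
      simpa [hv] using this
    · have := hup _ (Finset.mem_image_of_mem _ (Finset.mem_filter.2 ⟨hf, hv⟩))
      rw [le_div_iff₀ hv] at this
      linarith

theorem HalfspaceCone.project_sum {ι : Type*} {S : Set E} (hS : HalfspaceCone S) (v : ι → E)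
    (J : Finset ι) : HalfspaceCone {x | ∃ y : ι → ℝ, x - ∑ j ∈ J, y j • v j ∈ S} := by
  classical
  induction J using Finset.induction_on with
  | empty => simpa using hS
  | insert i J hi ih =>
    convert ih.project (v i) using 1
    ext x
    simp only [Set.mem_ofPred_eq, Finset.sum_insert hi]
    constructor
    · rintro ⟨y, hy⟩
      exact ⟨y i, y, by rwa [sub_sub]⟩
    · rintro ⟨t, y, hy⟩
      refine ⟨Function.update y i t, ?_⟩
      rw [Finset.sum_congr rfl fun j hj => by
        rw [Function.update_of_ne (ne_of_mem_of_not_mem hj hi)]]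
      rwa [Function.update_self, ← sub_sub]

end HalfspaceCone

/-! ### Minimal elements on compact sets -/

/-- A preorder whose lower sets are closed in a nonempty compact set has a minimal element there.
The relation `r a b` reads as `a` being at most `b`. -/
theorem IsCompact.exists_minimal_of_isClosed_lower {X : Type*} [TopologicalSpace X] {s : Set X}
    (hs : IsCompact s) (hne : s.Nonempty) (r : X → X → Prop) (hrefl : ∀ a, r a a)
    (htrans : ∀ {a b c}, r a b → r b c → r a c)
    (hclosed : ∀ a ∈ s, IsClosed {b | b ∈ s ∧ r b a}) :
    ∃ m ∈ s, ∀ a ∈ s, r a m → r m a := by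
  have : Nonempty s := hne.to_subtype
  obtain ⟨m, hm⟩ := exists_maximal_of_nonempty_chains_bounded (α := s)
    (r := fun a b => r b a) (fun C hC hCne => by
      have : Nonempty C := hCne.to_subtype
      obtain ⟨x, hx⟩ := IsCompact.nonempty_iInter_of_directed_nonempty_isCompact_isClosed
        (fun a : C => {b | b ∈ s ∧ r b a.1}) (by
          intro a b
          rcases eq_or_ne a.1 b.1 with h | h
          · exact ⟨a, subset_rfl, by simp [h]⟩
          rcases hC a.2 b.2 h with h | h
          · exact ⟨b, fun c hc => ⟨hc.1, htrans hc.2 h⟩, subset_rfl⟩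
          · exact ⟨a, subset_rfl, fun c hc => ⟨hc.1, htrans hc.2 h⟩⟩)
        (fun a => ⟨a.1, a.1.2, hrefl _⟩)
        (fun a => hs.of_isClosed_subset (hclosed _ a.1.2) fun b hb => hb.1)
        (fun a => hclosed _ a.1.2)
      simp only [Set.mem_iInter, Set.mem_ofPred_eq] at hx
      exact ⟨⟨x, (hx (Classical.arbitrary C)).1⟩, fun a ha => (hx ⟨a, ha⟩).2⟩)
    (fun h₁ h₂ => htrans h₂ h₁)
  exact ⟨m, m.2, fun a ha h => hm ⟨a, ha⟩ h⟩

namespace AdaptiveRobustProblem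

variable {L nx ny m : ℕ}

/-! ### The recourse linear program -/

/-- The pairs `(b, t)` for which some recourse decision `y` has `B y ≤ b` and cost at most `t`. -/
def recourseCone (P : AdaptiveRobustProblem L nx ny m) : Set ((Fin m → ℝ) × ℝ) :=
  {q | ∃ y : Fin ny → ℝ, P.B *ᵥ y ≤ q.1 ∧ P.d ⬝ᵥ y ≤ q.2}

theorem isClosed_recourseCone (P : AdaptiveRobustProblem L nx ny m) :
    IsClosed P.recourseCone := by
  classical
  have hpos : HalfspaceCone {q : (Fin m → ℝ) × ℝ | 0 ≤ q.1 ∧ 0 ≤ q.2} := by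
    refine ⟨insert (ContinuousLinearMap.snd ℝ _ _) (Finset.univ.image fun i =>
      (ContinuousLinearMap.proj (R := ℝ) (φ := fun _ : Fin m => ℝ) i).comp
        (ContinuousLinearMap.fst ℝ _ _)), ?_⟩
    ext q
    simp [Pi.le_def, and_comm]
  convert (hpos.project_sum (fun j : Fin ny => (fun i => P.B i j, P.d j)) Finset.univ).isClosed
    using 1
  ext q
  have h₁ (y : Fin ny → ℝ) : (∑ j, y j • ((fun i => P.B i j, P.d j) : (Fin m → ℝ) × ℝ)) =
      (P.B *ᵥ y, P.d ⬝ᵥ y) := by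
    ext <;> simp [Prod.fst_sum, Prod.snd_sum, Matrix.mulVec, dotProduct, mul_comm]
  simp only [recourseCone, Set.mem_ofPred_eq, h₁, Prod.fst_sub, Prod.snd_sub, sub_nonneg]

/-- If the optimal value is not `⊥`, no recession direction of the recourse constraints has
negative cost. -/
theorem dotProduct_nonneg_of_mulVec_nonpos (P : AdaptiveRobustProblem L nx ny m)
    (hne : P.feasibleRegion.Nonempty) (hbounded : P.optimalValue ≠ ⊥) {v : Fin ny → ℝ}
    (hv : P.B *ᵥ v ≤ 0) : 0 ≤ P.d ⬝ᵥ v := by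
  by_contra! hd
  refine hbounded (EReal.eq_bot_iff_forall_lt _ |>.2 fun t => ?_)
  obtain ⟨x, y, hy⟩ := hne
  -- The step `s z` along `v` brings the objective value in scenario `z` to at most `t - 1`, so the
  -- original rule need not have a bounded objective.
  set s : (Fin L → ℝ) → ℝ := fun z => max 0 ((t - 1 - P.objective x y z) / (P.d ⬝ᵥ v)) with hs
  have hARF : P.IsARF x fun z => y z + s z • v := by
    intro z hz
    have h₁ : s z • (P.B *ᵥ v) ≤ 0 := smul_nonpos_of_nonneg_of_nonpos (le_max_left _ _) hv
    have h₂ := hy z hz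
    rw [Matrix.mulVec_add, Matrix.mulVec_smul, ← add_assoc]
    exact (add_le_of_nonpos_right h₁).trans h₂
  have hle : P.worstCase x (fun z => y z + s z • v) ≤ ((t - 1 : ℝ) : EReal) := by
    refine iSup₂_le fun z _ => EReal.coe_le_coe_iff.2 ?_
    have h₁ : (t - 1 - P.objective x y z) / (P.d ⬝ᵥ v) ≤ s z := le_max_right _ _
    rw [div_le_iff_of_neg hd] at h₁
    simp only [objective, dotProduct_add, dotProduct_smul, smul_eq_mul] at h₁ ⊢
    linarith
  have hopt : P.optimalValue ≤ P.worstCase x fun z => y z + s z • v :=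
    (iInf_le _ x).trans ((iInf_le _ _).trans (iInf_le _ hARF))
  exact (hopt.trans hle).trans_lt
    (EReal.coe_lt_coe_iff.2 (by linarith))

/-- A feasible recourse linear program attains its minimum, if the optimal value of the adaptive
problem is not `⊥`. -/
theorem exists_minimal_recourse (P : AdaptiveRobustProblem L nx ny m)
    (hne : P.feasibleRegion.Nonempty) (hbounded : P.optimalValue ≠ ⊥) {b : Fin m → ℝ}
    {y₀ : Fin ny → ℝ} (hy₀ : P.B *ᵥ y₀ ≤ b) :
    ∃ y, P.B *ᵥ y ≤ b ∧ ∀ y', P.B *ᵥ y' ≤ b → P.d ⬝ᵥ y ≤ P.d ⬝ᵥ y' := by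
  set T : Set ℝ := {t | (b, t) ∈ P.recourseCone} with hT
  have hTc : IsClosed T := P.isClosed_recourseCone.preimage (by fun_prop)
  have hTb : BddBelow T := by
    by_contra hT'
    rw [not_bddBelow_iff] at hT'
    have hscaled (n : ℕ) : ((1 / ((n : ℝ) + 1)) • b, (-1 : ℝ)) ∈ P.recourseCone := by
      obtain ⟨t, ⟨y, hy, hyt⟩, ht⟩ := hT' (-((n : ℝ) + 1))
      have hn : (0 : ℝ) < 1 / ((n : ℝ) + 1) := by positivity
      refine ⟨(1 / ((n : ℝ) + 1)) • y, ?_, ?_⟩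
      · rw [Matrix.mulVec_smul]
        exact smul_le_smul_of_nonneg_left hy hn.le
      · rw [dotProduct_smul, smul_eq_mul, one_div, inv_mul_le_iff₀ (by positivity)]
        have hyt' : P.d ⬝ᵥ y ≤ t := hyt
        linarith
    have hlim : Filter.Tendsto (fun n : ℕ => ((1 / ((n : ℝ) + 1)) • b, (-1 : ℝ))) Filter.atTop
        (nhds ((0 : ℝ) • b, (-1 : ℝ))) :=
      (tendsto_one_div_add_atTop_nhds_zero_nat.smul_const b).prodMk_nhds tendsto_const_nhds
    obtain ⟨v, hv, hdv⟩ := P.isClosed_recourseCone.mem_of_tendsto hlim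
      (Filter.Eventually.of_forall hscaled)
    have h₁ := P.dotProduct_nonneg_of_mulVec_nonpos hne hbounded (v := v) (by simpa using hv)
    have h₂ : P.d ⬝ᵥ v ≤ -1 := hdv
    linarith
  obtain ⟨y, hy, hyt⟩ := hTc.csInf_mem ⟨P.d ⬝ᵥ y₀, y₀, hy₀, le_rfl⟩ hTb
  exact ⟨y, hy, fun y' hy' => hyt.trans (csInf_le hTb ⟨y', hy', le_rfl⟩)⟩

/-! ### Scenario-wise optimal decision rules -/

/-- The decision rule `y(·)` is feasible for `x` and optimal in every scenario of `U`. -/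
def IsOptimalRule (P : AdaptiveRobustProblem L nx ny m) (x : Fin nx → ℝ)
    (y : (Fin L → ℝ) → (Fin ny → ℝ)) : Prop :=
  P.IsARF x y ∧ ∀ z ∈ P.U, ∀ y' : Fin ny → ℝ, P.A z *ᵥ x + P.B *ᵥ y' ≤ P.r z →
    P.d ⬝ᵥ y z ≤ P.d ⬝ᵥ y'

theorem exists_optimal_recourse (P : AdaptiveRobustProblem L nx ny m)
    (hbounded : P.optimalValue ≠ ⊥) {x : Fin nx → ℝ} (hx : x ∈ P.feasibleRegion) :
    ∃ y, P.IsOptimalRule x y := by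
  obtain ⟨y₀, hy₀⟩ := hx
  have h (z : Fin L → ℝ) : ∃ y, z ∈ P.U → P.A z *ᵥ x + P.B *ᵥ y ≤ P.r z ∧
      ∀ y', P.A z *ᵥ x + P.B *ᵥ y' ≤ P.r z → P.d ⬝ᵥ y ≤ P.d ⬝ᵥ y' := by
    by_cases hz : z ∈ P.U
    · obtain ⟨y, hy⟩ := P.exists_minimal_recourse ⟨x, y₀, hy₀⟩ hbounded
        (le_sub_iff_add_le'.2 (hy₀ z hz))
      exact ⟨y, fun _ => by simpa only [le_sub_iff_add_le'] using hy⟩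
    · exact ⟨0, fun h => absurd h hz⟩
  choose y hy using h
  exact ⟨y, fun z hz => (hy z hz).1, fun z hz => (hy z hz).2⟩

theorem IsOptimalRule.objective_le {P : AdaptiveRobustProblem L nx ny m} {x : Fin nx → ℝ}
    {y y' : (Fin L → ℝ) → (Fin ny → ℝ)} (h : P.IsOptimalRule x y) (h' : P.IsARF x y')
    {z : Fin L → ℝ} (hz : z ∈ P.U) : P.objective x y z ≤ P.objective x y' z :=
  add_le_add_right (h.2 z hz _ (h' z hz)) _

theorem worstCase_le_iff {P : AdaptiveRobustProblem L nx ny m} {x : Fin nx → ℝ}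
    {y : (Fin L → ℝ) → (Fin ny → ℝ)} {w : EReal} :
    P.worstCase x y ≤ w ↔ ∀ z ∈ P.U, ∀ t : ℝ, w < t → P.objective x y z ≤ t := by
  simp only [worstCase, iSup₂_le_iff, ← EReal.le_of_forall_lt_iff_le (x := w),
    EReal.coe_le_coe_iff]
  exact ⟨fun h z hz t ht => h t ht z hz, fun h t ht z hz => h z hz t ht⟩

theorem worstCase_mono {P : AdaptiveRobustProblem L nx ny m} {x x' : Fin nx → ℝ}
    {y y' : (Fin L → ℝ) → (Fin ny → ℝ)}
    (h : ∀ z ∈ P.U, P.objective x y z ≤ P.objective x' y' z) :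
    P.worstCase x y ≤ P.worstCase x' y' :=
  iSup₂_mono fun z hz => EReal.coe_le_coe_iff.2 (h z hz)

/-- Any family of upper bounds `t` on the optimal objective values in scenarios `z` is a closed
condition on `x`. -/
theorem isClosed_setOf_recourse_le (P : AdaptiveRobustProblem L nx ny m)
    (hX : IsClosed P.feasibleRegion) {Y : (Fin nx → ℝ) → (Fin L → ℝ) → (Fin ny → ℝ)}
    (hY : ∀ x ∈ P.feasibleRegion, P.IsOptimalRule x (Y x)) (T : (Fin L → ℝ) → Set ℝ) :
    IsClosed {x | x ∈ P.feasibleRegion ∧ ∀ z ∈ P.U, ∀ t ∈ T z, P.objective x (Y x) z ≤ t} := by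
  have heq : {x | x ∈ P.feasibleRegion ∧ ∀ z ∈ P.U, ∀ t ∈ T z, P.objective x (Y x) z ≤ t} =
      P.feasibleRegion ∩ ⋂ z ∈ P.U, ⋂ t ∈ T z,
        (fun x => (P.r z - P.A z *ᵥ x, t - P.c z ⬝ᵥ x)) ⁻¹' P.recourseCone := by
    ext x
    simp only [Set.mem_ofPred_eq, Set.mem_inter_iff, Set.mem_iInter, Set.mem_preimage,
      recourseCone, le_sub_iff_add_le', objective]
    refine and_congr_right fun hx => forall₄_congr fun z hz t _ => ⟨fun h => ?_, ?_⟩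
    · exact ⟨Y x z, (hY x hx).1 z hz, h⟩
    · rintro ⟨y, hy, hyt⟩
      exact (add_le_add_right ((hY x hx).2 z hz y hy) _).trans hyt
  rw [heq]
  refine hX.inter (isClosed_biInter fun z _ => isClosed_biInter fun t _ =>
    P.isClosed_recourseCone.preimage ?_)
  exact (continuous_const.sub (Continuous.matrix_mulVec continuous_const continuous_id)).prodMk
    (continuous_const.sub (Continuous.dotProduct continuous_const continuous_id))

end AdaptiveRobustProblem

/-! ### Existence of a Pareto adaptive robustly optimal decision -/

open AdaptiveRobustProblem in
theorem mainTheorem1 {L nx ny m : ℕ} (P : AdaptiveRobustProblem L nx ny m)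
    (hUconvex : Convex ℝ P.U) (hUcompact : IsCompact P.U)
    (hUri : (intrinsicInterior ℝ P.U).Nonempty)
    (hXcompact : IsCompact P.feasibleRegion)
    (hXnonempty : P.feasibleRegion.Nonempty)
    (hbounded : P.optimalValue ≠ ⊥) :
    ∃ x : Fin nx → ℝ, P.IsPARO x := by
  have hex : ∀ x ∈ P.feasibleRegion, ∃ y, P.IsOptimalRule x y := fun x hx =>
    P.exists_optimal_recourse hbounded hx
  choose! Y hY using hex
  have hclosed := P.isClosed_setOf_recourse_le hXcompact.isClosed hY
  have hWclosed (w : EReal) :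
      IsClosed {x | x ∈ P.feasibleRegion ∧ P.worstCase x (Y x) ≤ w} := by
    simpa only [worstCase_le_iff, Set.mem_ofPred_eq] using hclosed fun _ => {t | w < t}
  obtain ⟨x₀, hx₀, hmin₀⟩ := hXcompact.exists_minimal_of_isClosed_lower hXnonempty
    (fun a b => P.worstCase a (Y a) ≤ P.worstCase b (Y b)) (fun _ => le_rfl)
    (fun h₁ h₂ => h₁.trans h₂) (fun a _ => hWclosed _)
  have hopt (x' y') (h : P.IsARF x' y') : P.worstCase x₀ (Y x₀) ≤ P.worstCase x' y' := by
    have h₁ : P.worstCase x' (Y x') ≤ P.worstCase x' y' :=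
      worstCase_mono fun z hz => (hY x' ⟨y', h⟩).objective_le h hz
    refine le_trans ?_ h₁
    rcases le_total (P.worstCase x₀ (Y x₀)) (P.worstCase x' (Y x')) with h₂ | h₂
    · exact h₂
    · exact hmin₀ x' ⟨y', h⟩ h₂
  set S : Set (Fin nx → ℝ) :=
    {x | x ∈ P.feasibleRegion ∧ P.worstCase x (Y x) ≤ P.worstCase x₀ (Y x₀)} with hS
  have hSclosed : IsClosed S := hWclosed _
  obtain ⟨x, hx, hmin⟩ :=
    (hXcompact.of_isClosed_subset hSclosed fun a ha => ha.1).exists_minimal_of_isClosed_lower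
      ⟨x₀, hx₀, le_rfl⟩
      (fun a b => ∀ z ∈ P.U, P.objective a (Y a) z ≤ P.objective b (Y b) z)
      (fun _ _ _ => le_rfl) (fun h₁ h₂ z hz => (h₁ z hz).trans (h₂ z hz)) (fun a _ => by
        convert hSclosed.inter (hclosed fun z => {P.objective a (Y a) z}) using 1
        ext b
        simp only [hS, Set.mem_ofPred_eq, Set.mem_inter_iff, Set.mem_singleton_iff, forall_eq]
        tauto)
  refine ⟨x, Y x, ⟨(hY x hx.1).1, fun x' y' h => hx.2.trans (hopt x' y' h)⟩, ?_⟩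
  rintro ⟨x', y', ⟨hARF, hARO⟩, hle, z, hz, hlt⟩
  have hY' := hY x' ⟨y', hARF⟩
  have hx' : x' ∈ S := ⟨⟨y', hARF⟩, (worstCase_mono fun z hz => hY'.objective_le hARF hz).trans
    (hARO x₀ (Y x₀) (hY x₀ hx₀).1)⟩
  have h₁ := hmin x' hx' fun z hz => (hY'.objective_le hARF hz).trans (hle z hz)
  exact absurd hlt (not_lt.2 ((h₁ z hz).trans (hY'.objective_le hARF hz)))
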